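/- For integers $n,r\ge 0$ let $\mathcal{B}_n(r)$ be the family of all subsets of $[n]=\{1,\dots,n\}$ of size at most $r$, and let the Hamming ball $B_n(r)$ be the graph with vertex set $\mathcal{B}_n(r)$ in which two subsets are adjacent if they differ by exactly one element (that is, their symmetric difference has size $1$). For a graph $G=(V,E)$ and $X\subseteq V$, the vertex boundary $\partial_G X$ is the set of vertices in $V\setminus X$ which have a neighbor in $X$. \textbf{Theorem (isoperimetric inequality for Hamming balls).} For every $\rho\in(0,1/2)$ there is a positive integer $n_0$, depending only on $\rho$, such that the following holds. For every integer $n\ge n_0$, every integer $R$ with $0\le R\le n/2$, and every $\mathcal{A}\subseteq\mathcal{B}_n(R)$, if $$|\mathcal{B}_n(\lfloor\rho n\rfloor)|\le|\mathcal{A}|\le|\mathcal{B}_n(R)|-|\mathcal{B}_n(\lfloor\rho n\rfloor)|,$$ then the vertex boundary of $\mathcal{A}$ in the Hamming ball $B_n(R)$ satisfies $$|\partial_{B_n(R)}\mathcal{A}|\ge\frac{\rho^{3/2}}{18\sqrt{n}}\min\bigl(|\mathcal{A}|,\,|\mathcal{B}_n(R)\setminus\mathcal{A}|\bigr).$$ 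-/

import Mathlib

/-- The vertex boundary of a set `X` of vertices of `G`: the vertices outside `X` which have a
neighbour in `X`. -/
def SimpleGraph.vertexBoundary {V : Type*} (G : SimpleGraph V) (X : Set V) : Set V :=
  {v | v ∉ X ∧ ∃ u ∈ X, G.Adj u v}

/-- The family of all subsets of an `n`-element set whose size is at most `r`. -/
def hammingBall (n r : ℕ) : Set (Finset (Fin n)) :=
  {X | X.card ≤ r}

/-- The Hamming ball as a graph: its vertices are the subsets of size at most `r`, and two of them
are adjacent if they differ by exactly one element. -/
def hammingBallGraph (n r : ℕ) : SimpleGraph (hammingBall n r) where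
  Adj X Y := (symmDiff (X : Finset (Fin n)) (Y : Finset (Fin n))).card = 1
  symm := ⟨fun X Y h => by rw [symmDiff_comm]; exact h⟩
  loopless := ⟨fun X h => by simp at h⟩

open Finset

/-! Let g(C) be the mean of a function f, |f| ≤ B, over the (k+1)-sets containing C. Exposing a
(k+1)-set S in random order turns g into a martingale from the mean of f to f(S). Averaging its
increments gives `layerFlow`, a flow on the edges T ⊂ T ∪ {a}, |T| = k, with no net flow at k-sets
and net flow f(S) minus the mean at S. It is cheap: by a Bessel inequality
(`sum_sliceAvg_insert_sub_sq_le`) the squared increments at a c-set sum to at most B²(n-c)/(k+1-c),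
so Cauchy–Schwarz and summing inverse square roots bound the absolute flow by O(Bn/√(k+1)) at a
k-set and O(B√(k+1)) at a (k+1)-set.

Sum the net flow over a family A. Edges inside A cancel and every crossing edge has its outer end in
the boundary, so the boundary controls the variance of A inside each layer
(`CoversBoundary.variance_slice_le`). Constant flows compare the densities of adjacent layers
(`CoversBoundary.density_sub_le`), and these comparisons add up because the sets of size at most i ≤
n/2 number at most 2√n·C(n,i).

With W the size of the ball and M the smaller of |A| and W-|A|, the variance |A|(W-|A|)/W is at
least M/2. It is at most the variance within layers plus the deviation between them. Layers up to ρn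
contribute at most a quarter of their size, hence at most M/4; above them the flow through a vertex
is O(√(n/ρ)). So M/4 is O(√(n/ρ)) times the boundary. -/

/-- The average of `F` over the subsets of `s` of size `i`. -/
noncomputable def sliceAvg {α : Type*} (s : Finset α) (i : ℕ) (F : Finset α → ℝ) : ℝ :=
  (∑ W ∈ powersetCard i s, F W) / (s.card.choose i : ℝ)

/-! ### Averages over the subsets of a fixed size, and a Bessel inequality. -/

section Slices

variable {α : Type*} [DecidableEq α]

theorem sum_powersetCard_succ_sum_erase (s : Finset α) (i : ℕ) (φ : Finset α → α → ℝ) :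
    ∑ W ∈ powersetCard (i + 1) s, ∑ a ∈ W, φ (W.erase a) a =
      ∑ a ∈ s, ∑ W ∈ powersetCard i (s.erase a), φ W a := by
  rw [Finset.sum_sigma', Finset.sum_sigma']
  refine Finset.sum_bij' (fun x _ => ⟨x.2, x.1.erase x.2⟩) (fun x _ => ⟨insert x.1 x.2, x.1⟩)
    ?_ ?_ ?_ ?_ ?_
  · rintro ⟨W, a⟩ h
    simp only [mem_sigma, mem_powersetCard] at h ⊢
    obtain ⟨⟨hW, hc⟩, ha⟩ := h
    exact ⟨hW ha, erase_subset_erase _ hW, by rw [card_erase_of_mem ha]; omega⟩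
  · rintro ⟨a, W⟩ h
    simp only [mem_sigma, mem_powersetCard] at h ⊢
    obtain ⟨ha, hW, hc⟩ := h
    have haW : a ∉ W := fun h' => by simpa using hW h'
    refine ⟨⟨?_, by rw [card_insert_of_notMem haW, hc]⟩, mem_insert_self _ _⟩
    exact insert_subset ha (hW.trans (erase_subset _ _))
  · rintro ⟨W, a⟩ h
    simp only [mem_sigma] at h
    simp [insert_erase h.2]
  · rintro ⟨a, W⟩ h
    simp only [mem_sigma, mem_powersetCard] at h
    have haW : a ∉ W := fun h' => by simpa using h.2.1 h'
    simp [erase_insert haW]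
  · rintro ⟨W, a⟩ h
    rfl

theorem sum_powersetCard_succ_sum_erase' (s : Finset α) (i : ℕ) (φ : Finset α → α → ℝ) :
    ∑ W ∈ powersetCard (i + 1) s, ∑ a ∈ W, φ (W.erase a) a =
      ∑ W ∈ powersetCard i s, ∑ a ∈ s \ W, φ W a := by
  rw [sum_powersetCard_succ_sum_erase]
  refine Finset.sum_comm' fun a W => ?_
  simp only [mem_powersetCard, mem_sdiff, subset_erase]
  tauto

theorem sum_powersetCard_succ_mul_sum (s : Finset α) (i : ℕ) (F : Finset α → ℝ) (c : α → ℝ) :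
    ∑ W ∈ powersetCard (i + 1) s, F W * ∑ a ∈ W, c a =
      ∑ a ∈ s, c a * ∑ W ∈ powersetCard i (s.erase a), F (insert a W) := by
  have h := sum_powersetCard_succ_sum_erase s i (fun W a => c a * F (insert a W))
  simp only [mul_sum]
  rw [← h]
  refine sum_congr rfl fun W _ => sum_congr rfl fun a ha => ?_
  rw [insert_erase ha, mul_comm]

theorem sum_powersetCard_succ_sum (s : Finset α) (i : ℕ) (c : α → ℝ) :
    ∑ W ∈ powersetCard (i + 1) s, ∑ a ∈ W, c a = ((s.card - 1).choose i : ℝ) * ∑ a ∈ s, c a := by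
  have h := sum_powersetCard_succ_mul_sum s i (fun _ => 1) c
  simp only [one_mul, sum_const, card_powersetCard, nsmul_eq_mul, mul_one] at h
  rw [h, mul_sum]
  refine sum_congr rfl fun a ha => ?_
  rw [card_erase_of_mem ha, mul_comm]

/-- Second moment of a linear statistic. As the weights sum to zero, the off-diagonal terms at `a`
give a multiple of `-c a ^ 2`, and Pascal's rule merges the two counts. -/
theorem sum_powersetCard_succ_sum_sq {s : Finset α} {N : ℕ} (hs : s.card = N + 2) (i : ℕ)
    {c : α → ℝ} (hc : ∑ a ∈ s, c a = 0) :
    ∑ W ∈ powersetCard (i + 1) s, (∑ a ∈ W, c a) ^ 2 = (N.choose i : ℝ) * ∑ a ∈ s, c a ^ 2 := by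
  have h := sum_powersetCard_succ_mul_sum s i (fun W => ∑ a ∈ W, c a) c
  simp only [← pow_two] at h
  rw [h, mul_sum]
  refine sum_congr rfl fun a ha => ?_
  have hcard : (s.erase a).card = N + 1 := by rw [card_erase_of_mem ha]; omega
  have hsum : ∑ b ∈ s.erase a, c b = - c a := by
    have := add_sum_erase s c ha
    linarith
  have h1 : ∀ W ∈ powersetCard i (s.erase a), ∑ b ∈ insert a W, c b = c a + ∑ b ∈ W, c b := by
    intro W hW
    rw [sum_insert]
    intro h'
    simpa using (mem_powersetCard.1 hW).1 h'
  rw [sum_congr rfl h1, sum_add_distrib, sum_const, card_powersetCard, hcard, nsmul_eq_mul]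
  cases i with
  | zero => simp; ring
  | succ j =>
    rw [sum_powersetCard_succ_sum, hcard, hsum, Nat.choose_succ_succ]
    push_cast
    ring

theorem sum_sliceAvg_insert {s : Finset α} {i : ℕ} (hi : i < s.card) (F : Finset α → ℝ) :
    ∑ a ∈ s, sliceAvg (s.erase a) i (fun W => F (insert a W)) =
      s.card * sliceAvg s (i + 1) F := by
  have h := sum_powersetCard_succ_mul_sum s i F (fun _ => 1)
  obtain ⟨N, hN⟩ : ∃ N, s.card = N + 1 := ⟨s.card - 1, by omega⟩
  have h1 : ∀ a ∈ s, sliceAvg (s.erase a) i (fun W => F (insert a W)) =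
      (∑ W ∈ powersetCard i (s.erase a), F (insert a W)) / (N.choose i : ℝ) := by
    intro a ha
    rw [sliceAvg, card_erase_of_mem ha, hN, Nat.add_sub_cancel]
  rw [sum_congr rfl h1, ← sum_div, sliceAvg, hN]
  simp only [sum_const, nsmul_eq_mul, mul_one, one_mul] at h
  rw [← h]
  have h2 : ∀ W ∈ powersetCard (i + 1) s, F W * (W.card : ℝ) = F W * ((i : ℝ) + 1) := by
    intro W hW
    rw [(mem_powersetCard.1 hW).2]; push_cast; rfl
  rw [sum_congr rfl h2, ← sum_mul]
  have hp : (0 : ℝ) < N.choose i := by exact_mod_cast Nat.choose_pos (by omega)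
  have hp' : (0 : ℝ) < (N + 1).choose (i + 1) := by exact_mod_cast Nat.choose_pos (by omega)
  have h3 : ((N : ℝ) + 1) * N.choose i = (N + 1).choose (i + 1) * ((i : ℝ) + 1) := by
    exact_mod_cast Nat.add_one_mul_choose_eq N i
  rw [div_eq_iff hp.ne', mul_div_assoc', div_mul_eq_mul_div, eq_div_iff hp'.ne']
  push_cast
  linear_combination (-(∑ W ∈ powersetCard (i + 1) s, F W)) * h3

/-- Conditioning on whether a random `(i + 1)`-subset contains `a`, an event of probability `(i + 1)
/ s.card`. -/
theorem sliceAvg_succ_eq {s : Finset α} {i : ℕ} (hi : i < s.card) (F : Finset α → ℝ) {a : α}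
    (ha : a ∈ s) :
    s.card * sliceAvg s (i + 1) F =
      (i + 1) * sliceAvg (s.erase a) i (fun W => F (insert a W)) +
        (s.card - (i + 1)) * sliceAvg (s.erase a) (i + 1) F := by
  obtain ⟨N, hN⟩ : ∃ N, s.card = N + 1 := ⟨s.card - 1, by omega⟩
  have hcard : (s.erase a).card = N := by rw [card_erase_of_mem ha]; omega
  have hna : a ∉ s.erase a := by simp
  have hsplit : ∑ W ∈ powersetCard (i + 1) s, F W =
      ∑ W ∈ powersetCard (i + 1) (s.erase a), F W +
        ∑ W ∈ powersetCard i (s.erase a), F (insert a W) := by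
    conv_lhs => rw [← insert_erase ha, powersetCard_succ_insert hna]
    rw [sum_union, sum_image]
    · intro W hW W' hW' h
      have h1 : a ∉ W := fun h' => hna ((mem_powersetCard.1 hW).1 h')
      have h2 : a ∉ W' := fun h' => hna ((mem_powersetCard.1 hW').1 h')
      rw [← erase_insert h1, ← erase_insert h2, h]
    · rw [disjoint_left]
      intro W hW hW'
      obtain ⟨W', -, rfl⟩ := mem_image.1 hW'
      exact hna ((mem_powersetCard.1 hW).1 (mem_insert_self _ _))
  rw [sliceAvg, sliceAvg, sliceAvg, hsplit, hN, hcard]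
  have hp : (0 : ℝ) < N.choose i := by exact_mod_cast Nat.choose_pos (by omega)
  have hp' : (0 : ℝ) < (N + 1).choose (i + 1) := by exact_mod_cast Nat.choose_pos (by omega)
  have h3 : ((N : ℝ) + 1) * N.choose i = (N + 1).choose (i + 1) * ((i : ℝ) + 1) := by
    exact_mod_cast Nat.add_one_mul_choose_eq N i
  have h4 : ((N + 1).choose (i + 1) : ℝ) = N.choose i + N.choose (i + 1) := by
    exact_mod_cast Nat.choose_succ_succ N i
  have e1 : ((N : ℝ) + 1) / ((N + 1).choose (i + 1) : ℝ) = ((i : ℝ) + 1) / N.choose i := by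
    rw [div_eq_div_iff hp'.ne' hp.ne']; linarith
  rcases Nat.eq_or_lt_of_le (show i + 1 ≤ N + 1 by omega) with h | h
  · have : i = N := by omega
    subst this
    rw [powersetCard_eq_empty.2 (by omega)]
    simp
  · have hp2 : (0 : ℝ) < N.choose (i + 1) := by exact_mod_cast Nat.choose_pos (by omega)
    have e2 : ((N : ℝ) + 1) / ((N + 1).choose (i + 1) : ℝ) =
        ((N : ℝ) + 1 - (i + 1)) / N.choose (i + 1) := by
      rw [div_eq_div_iff hp'.ne' hp2.ne', h4]
      rw [h4] at h3
      linarith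
    push_cast
    set x := ∑ W ∈ powersetCard (i + 1) (s.erase a), F W
    set y := ∑ W ∈ powersetCard i (s.erase a), F (insert a W)
    calc _ = ((N : ℝ) + 1) / ((N + 1).choose (i + 1) : ℝ) * y +
          ((N : ℝ) + 1) / ((N + 1).choose (i + 1) : ℝ) * x := by ring
      _ = ((i : ℝ) + 1) / N.choose i * y + ((N : ℝ) + 1 - (i + 1)) / N.choose (i + 1) * x := by
          nth_rewrite 1 [e1]; rw [e2]
      _ = _ := by ring

omit [DecidableEq α] in
theorem abs_sliceAvg_le {s : Finset α} {i : ℕ} {F : Finset α → ℝ} {B : ℝ} (hB : 0 ≤ B)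
    (hF : ∀ W ∈ powersetCard i s, |F W| ≤ B) : |sliceAvg s i F| ≤ B := by
  rw [sliceAvg, abs_div, Nat.abs_cast]
  refine div_le_of_le_mul₀ (Nat.cast_nonneg _) hB ?_
  refine (abs_sum_le_sum_abs _ _).trans ((sum_le_sum hF).trans ?_)
  rw [sum_const, card_powersetCard, nsmul_eq_mul, mul_comm]

/-- The inclusion indicators of a random `(i + 1)`-subset explain little of the variance of a
bounded function of it. -/
theorem sum_sliceAvg_insert_sub_sq_le {s : Finset α} {i : ℕ} (hi : i < s.card)
    {F : Finset α → ℝ} {B : ℝ} (hF : ∀ W ∈ powersetCard (i + 1) s, |F W| ≤ B) :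
    ∑ a ∈ s, (sliceAvg (s.erase a) i (fun W => F (insert a W)) - sliceAvg s (i + 1) F) ^ 2 ≤
      B ^ 2 * (s.card * (s.card - (i + 1)) / ((i + 1) * (s.card - 1))) := by
  set c : α → ℝ := fun a =>
    sliceAvg (s.erase a) i (fun W => F (insert a W)) - sliceAvg s (i + 1) F with hc
  have hc0 : ∑ a ∈ s, c a = 0 := by
    rw [hc, sum_sub_distrib, sum_sliceAvg_insert hi]; simp
  obtain ⟨N, hN⟩ : ∃ N, s.card = N + 1 := ⟨s.card - 1, by omega⟩
  cases N with
  | zero =>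
    -- For a singleton the bound is a division by zero, hence 0, and the only coefficient vanishes.
    obtain ⟨a, rfl⟩ := card_eq_one.1 hN
    simp only [sum_singleton] at hc0
    change ∑ a ∈ _, c a ^ 2 ≤ _
    simp [hc0]
  | succ N =>
    change ∑ a ∈ s, c a ^ 2 ≤ _
    set Q := ∑ a ∈ s, c a ^ 2 with hQ
    have hp : (0 : ℝ) < (N + 1).choose i := by exact_mod_cast Nat.choose_pos (by omega)
    -- The pairing of `F` with the linear statistic of `c` is a multiple of `Q`, and so is the
    -- second moment of that statistic; Cauchy–Schwarz then bounds `Q`.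
    have h1 : ((N + 1).choose i : ℝ) * Q = ∑ W ∈ powersetCard (i + 1) s, F W * ∑ a ∈ W, c a := by
      rw [sum_powersetCard_succ_mul_sum]
      have : Q = ∑ a ∈ s, c a * sliceAvg (s.erase a) i (fun W => F (insert a W)) := by
        have : ∀ a ∈ s, c a ^ 2 = c a * sliceAvg (s.erase a) i (fun W => F (insert a W)) -
            c a * sliceAvg s (i + 1) F := fun a _ => by simp only [hc]; ring
        rw [hQ, sum_congr rfl this, sum_sub_distrib, ← sum_mul, hc0]
        ring
      rw [this, mul_sum]
      refine sum_congr rfl fun a ha => ?_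
      rw [sliceAvg, card_erase_of_mem ha, hN]
      simp only [Nat.add_sub_cancel]
      field_simp
    have h2 : (((N + 1).choose i : ℝ) * Q) ^ 2 ≤
        ((N + 2).choose (i + 1) * B ^ 2) * (N.choose i * Q) := by
      rw [h1, ← sum_powersetCard_succ_sum_sq hN i hc0]
      refine (sum_mul_sq_le_sq_mul_sq _ _ _).trans ?_
      refine mul_le_mul_of_nonneg_right ?_ (sum_nonneg fun _ _ => sq_nonneg _)
      rw [show N + 2 = s.card from hN.symm, ← card_powersetCard, ← nsmul_eq_mul, ← sum_const]
      exact sum_le_sum fun W hW => sq_le_sq' (abs_le.1 (hF W hW)).1 (abs_le.1 (hF W hW)).2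
    have h3 : ((N : ℝ) + 2) * (N + 1).choose i = (N + 2).choose (i + 1) * ((i : ℝ) + 1) := by
      have := Nat.add_one_mul_choose_eq (N + 1) i
      have := congrArg (Nat.cast : ℕ → ℝ) this
      push_cast at this
      linarith
    have h4 : ((N : ℝ) + 1) * N.choose i = (N + 1).choose i * ((N : ℝ) + 1 - i) := by
      have := Nat.choose_mul_succ_eq N i
      have := congrArg (Nat.cast : ℕ → ℝ) this
      rw [Nat.cast_mul, Nat.cast_mul, Nat.cast_sub (by omega)] at this
      push_cast at this
      linarith
    have hQ0 : 0 ≤ Q := sum_nonneg fun _ _ => sq_nonneg _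
    have e3 : ((N + 2).choose (i + 1) : ℝ) = ((N : ℝ) + 2) * (N + 1).choose i / (i + 1) := by
      rw [h3]; field_simp
    have e4 : (N.choose i : ℝ) = (N + 1).choose i * ((N : ℝ) + 1 - i) / (N + 1) := by
      rw [← h4]; field_simp
    rw [e3, e4] at h2
    rw [hN]
    push_cast
    have hi' : (i : ℝ) ≤ N + 1 := by exact_mod_cast (by omega : i ≤ N + 1)
    rcases hQ0.eq_or_lt with h0 | h0
    · rw [← h0]
      have : (0:ℝ) ≤ (N + 1 + 1 - (i + 1)) := by linarith
      have h' : (0:ℝ) ≤ ((N:ℝ) + 1 + 1 - 1) := by linarith [(Nat.cast_nonneg N : (0:ℝ) ≤ N)]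
      positivity
    · have hpos : 0 < ((N + 1).choose i : ℝ) ^ 2 * Q := by positivity
      refine le_of_mul_le_mul_left ?_ hpos
      calc _ = (((N + 1).choose i : ℝ) * Q) ^ 2 := by ring
        _ ≤ _ := h2
        _ = _ := by
          rw [show (N : ℝ) + 1 + 1 - 1 = N + 1 by ring]
          field_simp
          ring

end Slices

/-! ### Elementary inequalities, then the flow between consecutive layers. -/

section Flow

theorem sum_sqrt_inv_le (k : ℕ) : ∑ i ∈ range k, 1 / √((i : ℝ) + 1) ≤ 2 * √k := by
  induction k with
  | zero => simp
  | succ k ih =>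
    rw [sum_range_succ]
    push_cast
    have h0 : 0 < √((k : ℝ) + 1) := Real.sqrt_pos.2 (by positivity)
    have h1 : √((k : ℝ) + 1) ^ 2 = k + 1 := Real.sq_sqrt (by positivity)
    have h2 : √(k : ℝ) ^ 2 = k := Real.sq_sqrt (by positivity)
    have : 1 / √((k : ℝ) + 1) ≤ 2 * √((k : ℝ) + 1) - 2 * √k := by
      rw [div_le_iff₀ h0]
      nlinarith [sq_nonneg (√((k : ℝ) + 1) - √k)]
    linarith

theorem sum_sqrt_inv_reflect_le (k : ℕ) :
    ∑ i ∈ range k, 1 / √((k : ℝ) - i) ≤ 2 * √k := by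
  refine le_trans (le_of_eq ?_) (sum_sqrt_inv_le k)
  rw [← sum_range_reflect]
  refine sum_congr rfl fun i hi => ?_
  have hi := mem_range.1 hi
  rw [Nat.cast_sub (by omega), Nat.cast_sub (by omega)]
  congr 2
  push_cast
  ring

theorem sum_abs_le_sqrt_mul_sqrt {ι : Type*} (s : Finset ι) (c : ι → ℝ) :
    ∑ a ∈ s, |c a| ≤ √s.card * √(∑ a ∈ s, c a ^ 2) := by
  rw [← Real.sqrt_mul (Nat.cast_nonneg _)]
  refine Real.le_sqrt_of_sq_le ?_
  have := sq_sum_le_card_mul_sum_sq (s := s) (f := fun a => |c a|)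
  simpa using this

/-- `layerFlow` must subtract the mean over `Tᶜ` to be conservative, while its terms are known to be
small around another centre; the change of centre costs a factor 2. -/
theorem sum_abs_sub_avg_le {ι : Type*} (s : Finset ι) (x : ι → ℝ) (p : ℝ) :
    ∑ a ∈ s, |x a - (∑ b ∈ s, x b) / s.card| ≤ 2 * ∑ a ∈ s, |x a - p| := by
  rcases s.eq_empty_or_nonempty with rfl | hs
  · simp
  have hc : (0 : ℝ) < s.card := by exact_mod_cast hs.card_pos
  have h1 : (∑ b ∈ s, x b) / s.card - p = (∑ b ∈ s, (x b - p)) / s.card := by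
    rw [sum_sub_distrib, sum_const, nsmul_eq_mul]; field_simp
  have h2 : s.card * |(∑ b ∈ s, x b) / s.card - p| ≤ ∑ a ∈ s, |x a - p| := by
    rw [h1, abs_div, Nat.abs_cast, mul_div_cancel₀ _ hc.ne']
    exact abs_sum_le_sum_abs (fun b => x b - p) s
  calc _ ≤ ∑ a ∈ s, (|x a - p| + |(∑ b ∈ s, x b) / s.card - p|) :=
        sum_le_sum fun a _ => by
          rw [abs_sub_comm ((∑ b ∈ s, x b) / s.card) p]
          exact abs_sub_le (x a) p ((∑ b ∈ s, x b) / s.card)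
    _ ≤ _ := by
      rw [sum_add_distrib, sum_const, nsmul_eq_mul]; linarith

theorem sliceAvg_sub {α : Type*} (s : Finset α) (i : ℕ) (F G : Finset α → ℝ) :
    sliceAvg s i (fun W => F W - G W) = sliceAvg s i F - sliceAvg s i G := by
  simp [sliceAvg, sum_sub_distrib, sub_div]

theorem sum_abs_sliceAvg_le {α ι : Type*} {s : Finset α} {i : ℕ} {t : Finset ι}
    {F : ι → Finset α → ℝ} {D : ℝ} (hD : 0 ≤ D)
    (hF : ∀ W ∈ powersetCard i s, ∑ a ∈ t, |F a W| ≤ D) :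
    ∑ a ∈ t, |sliceAvg s i (F a)| ≤ D := by
  simp only [sliceAvg, abs_div, Nat.abs_cast]
  rw [← sum_div]
  refine div_le_of_le_mul₀ (Nat.cast_nonneg _) hD ?_
  calc _ ≤ ∑ a ∈ t, ∑ W ∈ powersetCard i s, |F a W| :=
        sum_le_sum fun a _ => abs_sum_le_sum_abs _ _
    _ = ∑ W ∈ powersetCard i s, ∑ a ∈ t, |F a W| := sum_comm
    _ ≤ ∑ W ∈ powersetCard i s, D := sum_le_sum hF
    _ = _ := by rw [sum_const, card_powersetCard, nsmul_eq_mul, mul_comm]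

variable {α : Type*} [DecidableEq α] [Fintype α]

local notation "N" => (Fintype.card α : ℝ)

/-- The average of `f` over the sets of size `k` which contain `C`. -/
noncomputable def supersetAvg (k : ℕ) (f : Finset α → ℝ) (C : Finset α) : ℝ :=
  sliceAvg Cᶜ (k - C.card) fun W => f (C ∪ W)

theorem supersetAvg_insert {k : ℕ} {f : Finset α → ℝ} {C : Finset α} {b : α} (hb : b ∈ Cᶜ) :
    supersetAvg (k + 1) f (insert b C) =
      sliceAvg (Cᶜ.erase b) (k - C.card) fun W => f (C ∪ insert b W) := by
  rw [supersetAvg, card_insert_of_notMem (mem_compl.1 hb), compl_insert, Nat.add_sub_add_right]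
  simp only [insert_union, union_insert]

theorem supersetAvg_of_card_eq {k : ℕ} {f : Finset α → ℝ} {C : Finset α} (hC : C.card = k) :
    supersetAvg k f C = f C := by
  simp [supersetAvg, sliceAvg, hC]

/-- The martingale property of `supersetAvg`. -/
theorem sum_supersetAvg_insert {k : ℕ} (hk : k + 1 ≤ Fintype.card α) (f : Finset α → ℝ)
    {C : Finset α} (hC : C.card ≤ k) :
    ∑ b ∈ Cᶜ, supersetAvg (k + 1) f (insert b C) = (N - C.card) * supersetAvg (k + 1) f C := by
  have hcc : Cᶜ.card = Fintype.card α - C.card := card_compl C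
  rw [sum_congr rfl fun b hb => supersetAvg_insert (k := k) (f := f) hb,
    sum_sliceAvg_insert (by omega) (fun W => f (C ∪ W)), supersetAvg, hcc,
    Nat.cast_sub (by omega), Nat.sub_add_comm hC]

theorem abs_supersetAvg_le {k : ℕ} {f : Finset α → ℝ} {B : ℝ} (hB : 0 ≤ B)
    (hf : ∀ S : Finset α, S.card = k → |f S| ≤ B) {C : Finset α} (hC : C.card ≤ k) :
    |supersetAvg k f C| ≤ B := by
  refine abs_sliceAvg_le hB fun W hW => hf _ ?_
  rw [mem_powersetCard] at hW
  rw [card_union_of_disjoint, hW.2]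
  · omega
  · exact (disjoint_compl_right.mono_right hW.1)

theorem sum_supersetAvg_insert_sub_sq_le {k : ℕ} (hk : k + 1 ≤ Fintype.card α)
    {f : Finset α → ℝ} {B : ℝ} (hf : ∀ S : Finset α, S.card = k + 1 → |f S| ≤ B)
    {C : Finset α} (hC : C.card ≤ k) :
    ∑ b ∈ Cᶜ, (supersetAvg (k + 1) f (insert b C) - supersetAvg (k + 1) f C) ^ 2 ≤
      B ^ 2 * ((N - C.card) / (k + 1 - C.card)) := by
  have hcc : Cᶜ.card = Fintype.card α - C.card := card_compl C
  have h := sum_sliceAvg_insert_sub_sq_le (s := Cᶜ) (i := k - C.card) (by omega)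
    (F := fun W => f (C ∪ W)) (B := B) (by
      intro W hW
      rw [mem_powersetCard] at hW
      refine hf _ ?_
      rw [card_union_of_disjoint, hW.2]
      · omega
      · exact (disjoint_compl_right.mono_right hW.1))
  rw [sum_congr rfl fun b hb => by rw [supersetAvg_insert (k := k) (f := f) hb], supersetAvg,
    Nat.sub_add_comm hC]
  refine h.trans (mul_le_mul_of_nonneg_left ?_ (sq_nonneg _))
  rw [hcc, Nat.cast_sub (by omega), Nat.cast_sub hC]
  have h1 : ((k : ℝ) + 1) ≤ N := by exact_mod_cast hk
  have h2 : (C.card : ℝ) ≤ k := by exact_mod_cast hC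
  have h3 : (0 : ℝ) < (k : ℝ) - C.card + 1 := by linarith
  rw [mul_div_mul_comm, show (k : ℝ) + 1 - C.card = k - C.card + 1 by ring]
  refine mul_le_of_le_one_right (div_nonneg (by linarith) h3.le) ?_
  exact div_le_one_of_le₀ (by linarith) (by linarith)

/-- The average of `g` over the sets which contain `a` and `c` elements of `T`. -/
noncomputable def pinnedAvg (g : Finset α → ℝ) (c : ℕ) (T : Finset α) (a : α) : ℝ :=
  sliceAvg T c fun C => g (insert a C)

/-- A flow along the edges between the layers `k` and `k + 1`: it is conservative at the sets of
size `k`, and its divergence on the layer `k + 1` is `f` minus the mean of `f`. -/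
noncomputable def layerFlow (k : ℕ) (f : Finset α → ℝ) (T : Finset α) (a : α) : ℝ :=
  (∑ c ∈ range (k + 1), (N - k) / (N - c) *
    (pinnedAvg (supersetAvg (k + 1) f) c T a -
      (∑ b ∈ Tᶜ, pinnedAvg (supersetAvg (k + 1) f) c T b) / Tᶜ.card)) / (k + 1)

theorem sum_layerFlow (k : ℕ) (f : Finset α → ℝ) (T : Finset α) :
    ∑ a ∈ Tᶜ, layerFlow k f T a = 0 := by
  simp only [layerFlow]
  rw [← sum_div, sum_comm, sum_eq_zero, zero_div]
  intro c _
  rw [← mul_sum, sum_sub_distrib, sum_const, nsmul_eq_mul]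
  rcases (Tᶜ).eq_empty_or_nonempty with h | h
  · simp [h]
  · have hc : (Tᶜ.card : ℝ) ≠ 0 := by exact_mod_cast h.card_pos.ne'
    rw [mul_div_cancel₀ _ hc]
    simp

theorem sum_abs_pinnedAvg_sub_le {k : ℕ} (hk : k + 1 ≤ Fintype.card α)
    {f : Finset α → ℝ} {B : ℝ} (hB : 0 ≤ B) (hf : ∀ S : Finset α, S.card = k + 1 → |f S| ≤ B)
    {T : Finset α} (hT : T.card = k) {c : ℕ} (hc : c ≤ k) :
    ∑ a ∈ Tᶜ, |pinnedAvg (supersetAvg (k + 1) f) c T a - sliceAvg T c (supersetAvg (k + 1) f)| ≤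
      √(N - k) * (B * √((N - c) / (k + 1 - c))) := by
  simp only [pinnedAvg, ← sliceAvg_sub]
  refine sum_abs_sliceAvg_le (by positivity) fun C hC => ?_
  rw [mem_powersetCard] at hC
  refine (sum_abs_le_sqrt_mul_sqrt _ _).trans ?_
  rw [card_compl, hT, Nat.cast_sub (by omega)]
  refine mul_le_mul_of_nonneg_left ?_ (Real.sqrt_nonneg _)
  rw [← Real.sqrt_sq hB, ← Real.sqrt_mul (sq_nonneg _)]
  refine Real.sqrt_le_sqrt ?_
  have h := sum_supersetAvg_insert_sub_sq_le hk hf (C := C) (by omega)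
  rw [hC.2] at h
  -- The Bessel inequality covers all of `Cᶜ`, which contains `Tᶜ` because `C ⊆ T`.
  refine le_trans (sum_le_sum_of_subset_of_nonneg ?_ fun _ _ _ => sq_nonneg _) h
  exact compl_subset_compl.2 hC.1

theorem sum_abs_layerFlow_lower_le {k : ℕ} (hk : k + 1 ≤ Fintype.card α)
    {f : Finset α → ℝ} {B : ℝ} (hB : 0 ≤ B) (hf : ∀ S : Finset α, S.card = k + 1 → |f S| ≤ B)
    {T : Finset α} (hT : T.card = k) :
    ∑ a ∈ Tᶜ, |layerFlow k f T a| ≤ 4 * B * (N - k) / √((k : ℝ) + 1) := by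
  have h1 : ((k : ℝ) + 1) ≤ N := by exact_mod_cast hk
  have hterm : ∀ c ∈ range (k + 1), ∑ a ∈ Tᶜ, |(N - k) / (N - c) *
      (pinnedAvg (supersetAvg (k + 1) f) c T a -
        (∑ b ∈ Tᶜ, pinnedAvg (supersetAvg (k + 1) f) c T b) / Tᶜ.card)| ≤
      2 * B * (N - k) * (1 / √(((k + 1 : ℕ) : ℝ) - c)) := by
    intro c hc
    have hc : c ≤ k := by have := mem_range.1 hc; omega
    have hc' : (c : ℝ) ≤ k := by exact_mod_cast hc
    have hq : 0 < N - k := by linarith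
    have hq' : 0 < N - c := by linarith
    have hi : 0 < (k : ℝ) + 1 - c := by linarith
    simp only [abs_mul, ← mul_sum]
    rw [abs_of_pos (div_pos hq hq')]
    have hA := (sum_abs_sub_avg_le Tᶜ (fun a => pinnedAvg (supersetAvg (k + 1) f) c T a)
      (sliceAvg T c (supersetAvg (k + 1) f))).trans
        (mul_le_mul_of_nonneg_left (sum_abs_pinnedAvg_sub_le hk hB hf hT hc) zero_le_two)
    refine (mul_le_mul_of_nonneg_left hA (div_pos hq hq').le).trans ?_
    rw [Real.sqrt_div hq'.le]
    push_cast
    have e1 : √(N - k) ≤ √(N - c) := Real.sqrt_le_sqrt (by linarith)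
    have e2 : √(N - c) * √(N - c) = N - c := Real.mul_self_sqrt hq'.le
    have e3 : √(N - k) * √(N - c) / (N - c) ≤ 1 := by
      rw [div_le_one hq']
      nlinarith [Real.sqrt_nonneg (N - c)]
    calc _ = 2 * B * (N - k) * (1 / √((k : ℝ) + 1 - c)) * (√(N - k) * √(N - c) / (N - c)) := by
          ring
      _ ≤ _ := mul_le_of_le_one_right (by positivity) e3
  simp only [layerFlow, abs_div]
  rw [← sum_div, abs_of_pos (by positivity : (0 : ℝ) < (k : ℝ) + 1), div_le_div_iff₀ (by positivity)
    (Real.sqrt_pos.2 (by positivity))]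
  have hsum := sum_sqrt_inv_reflect_le (k + 1)
  have hq : 0 ≤ N - k := by linarith
  have : ∑ a ∈ Tᶜ, |∑ c ∈ range (k + 1), (N - k) / (N - c) *
      (pinnedAvg (supersetAvg (k + 1) f) c T a -
        (∑ b ∈ Tᶜ, pinnedAvg (supersetAvg (k + 1) f) c T b) / Tᶜ.card)| ≤
      2 * B * (N - k) * (2 * √((k : ℝ) + 1)) := by
    refine (sum_le_sum fun a _ => abs_sum_le_sum_abs _ _).trans ?_
    rw [sum_comm]
    refine (sum_le_sum hterm).trans ?_
    rw [← mul_sum]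
    push_cast at hsum ⊢
    exact mul_le_mul_of_nonneg_left hsum (by positivity)
  refine (mul_le_mul_of_nonneg_right this (Real.sqrt_nonneg _)).trans (le_of_eq ?_)
  have := Real.mul_self_sqrt (by positivity : (0 : ℝ) ≤ (k : ℝ) + 1)
  linear_combination 4 * B * (N - k) * this

/-- The martingale property at each `c`-subset `C` of `T`, with `Cᶜ` split into `Tᶜ` and `T \ C`.
The second part produces every `(c + 1)`-subset of `T` exactly `c + 1` times. -/
theorem sum_pinnedAvg_compl {k : ℕ} (hk : k + 1 ≤ Fintype.card α) (f : Finset α → ℝ)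
    {T : Finset α} (hT : T.card = k) {c : ℕ} (hc : c ≤ k) :
    ∑ b ∈ Tᶜ, pinnedAvg (supersetAvg (k + 1) f) c T b =
      (N - c) * sliceAvg T c (supersetAvg (k + 1) f) -
        (k - c) * sliceAvg T (c + 1) (supersetAvg (k + 1) f) := by
  set g := supersetAvg (k + 1) f with hg
  have h1 : (N - c) * ∑ C ∈ powersetCard c T, g C =
      ∑ C ∈ powersetCard c T, ∑ b ∈ Tᶜ, g (insert b C) +
        (c + 1) * ∑ W ∈ powersetCard (c + 1) T, g W := by
    have h2 := sum_powersetCard_succ_sum_erase' T c (fun W a => g (insert a W))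
    have h3 : ∑ W ∈ powersetCard (c + 1) T, ∑ a ∈ W, g (insert a (W.erase a)) =
        (c + 1) * ∑ W ∈ powersetCard (c + 1) T, g W := by
      rw [mul_sum]
      refine sum_congr rfl fun W hW => ?_
      rw [sum_congr rfl fun a ha => by rw [insert_erase ha], sum_const,
        (mem_powersetCard.1 hW).2, nsmul_eq_mul]
      push_cast; rfl
    rw [← h3, h2, ← sum_add_distrib, mul_sum]
    refine sum_congr rfl fun C hC => ?_
    rw [mem_powersetCard] at hC
    have := sum_supersetAvg_insert hk f (C := C) (by omega)
    rw [hC.2] at this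
    rw [hg, ← this, ← sum_union]
    · congr 1
      ext x
      have := @hC.1 x
      simp only [mem_compl, mem_union, mem_sdiff]
      tauto
    · rw [disjoint_left]
      intro x hx hx'
      exact (mem_compl.1 hx) (mem_sdiff.1 hx').1
  have hp : (0 : ℝ) < k.choose c := by exact_mod_cast Nat.choose_pos hc
  have h4 : (k.choose (c + 1) : ℝ) * (c + 1) = k.choose c * (k - c) := by
    rw [← Nat.cast_sub hc]; exact_mod_cast Nat.choose_succ_right_eq k c
  simp only [pinnedAvg, sliceAvg, hT]
  rw [← sum_div, sum_comm, div_eq_iff hp.ne', sub_mul, mul_assoc, div_mul_cancel₀ _ hp.ne', h1]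
  rcases hc.eq_or_lt with rfl | hlt
  · have h5 : powersetCard (c + 1) T = ∅ := powersetCard_eq_empty.2 (by omega)
    simp [h5]
  · have hp' : (0 : ℝ) < k.choose (c + 1) := by exact_mod_cast Nat.choose_pos hlt
    field_simp
    linear_combination (-(∑ W ∈ powersetCard (c + 1) T, g W)) * h4

/-- The weights `(N - k) / (N - c)` are those for which the subtracted means telescope in `c`. -/
theorem layerFlow_eq {k : ℕ} (hk : k + 1 ≤ Fintype.card α) (f : Finset α → ℝ)
    {T : Finset α} (hT : T.card = k) {a : α} (ha : a ∉ T) :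
    (k + 1) * layerFlow k f T a = f (insert a T) - supersetAvg (k + 1) f ∅ +
      ∑ c ∈ range k, (N - k) / (N - c) * (pinnedAvg (supersetAvg (k + 1) f) c T a -
        sliceAvg T (c + 1) (supersetAvg (k + 1) f)) := by
  have h1 : ((k : ℝ) + 1) ≤ N := by exact_mod_cast hk
  have hTc : (Tᶜ.card : ℝ) = N - k := by rw [card_compl, hT, Nat.cast_sub (by omega)]
  set g := supersetAvg (k + 1) f with hg
  -- At `c = k` the average over `(k + 1)`-subsets of `T` is vacuous, but it occurs with both signs
  -- and cancels.
  have hterm : ∀ c ∈ range (k + 1), (N - k) / (N - c) * (pinnedAvg g c T a -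
      (∑ b ∈ Tᶜ, pinnedAvg g c T b) / Tᶜ.card) =
      (N - k) / (N - c) * (pinnedAvg g c T a - sliceAvg T (c + 1) g) +
        (sliceAvg T (c + 1) g - sliceAvg T c g) := by
    intro c hc
    have hc : c ≤ k := by have := mem_range.1 hc; omega
    have hc' : (c : ℝ) ≤ k := by exact_mod_cast hc
    have hq : N - k ≠ 0 := by linarith
    have hq' : N - c ≠ 0 := by linarith
    rw [sum_pinnedAvg_compl hk f hT hc, hTc, ← hg]
    field_simp
    ring
  rw [layerFlow, mul_div_cancel₀ _ (by positivity), sum_congr rfl hterm, sum_add_distrib,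
    sum_range_sub (fun c => sliceAvg T c g), sum_range_succ]
  have hq : N - k ≠ 0 := by linarith
  have e1 : pinnedAvg g k T a = f (insert a T) := by
    have : (insert a T).card = k + 1 := by rw [card_insert_of_notMem ha, hT]
    rw [pinnedAvg, sliceAvg, ← hT, powersetCard_self]
    simp [hg, supersetAvg_of_card_eq this]
  have e2 : sliceAvg T 0 g = g ∅ := by simp [sliceAvg]
  rw [e1, e2, div_self hq]
  ring

omit [Fintype α] in
-- By `sliceAvg_succ_eq`, containing versus avoiding `a` is a fixed multiple of containing `a`
-- versus no condition, and the latter differences average to zero.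
theorem sum_pinnedAvg_erase_sub (g : Finset α → ℝ) {S : Finset α} {c : ℕ}
    (hc : c + 1 < S.card) :
    ∑ a ∈ S, (pinnedAvg g c (S.erase a) a - sliceAvg (S.erase a) (c + 1) g) = 0 := by
  have h1 : ∀ a ∈ S, pinnedAvg g c (S.erase a) a - sliceAvg (S.erase a) (c + 1) g =
      S.card / (S.card - (c + 1)) * (pinnedAvg g c (S.erase a) a - sliceAvg S (c + 1) g) := by
    intro a ha
    have h := sliceAvg_succ_eq (show c < S.card by omega) g ha
    have hpos : (0 : ℝ) < S.card - (c + 1) := by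
      have : ((c + 1 : ℕ) : ℝ) < S.card := by exact_mod_cast hc
      push_cast at this; linarith
    rw [pinnedAvg, div_mul_eq_mul_div, eq_div_iff hpos.ne']
    linear_combination h
  rw [sum_congr rfl h1, ← mul_sum, sum_sub_distrib]
  simp only [pinnedAvg]
  rw [sum_sliceAvg_insert (by omega) g]
  simp

omit [Fintype α] in
theorem sum_abs_pinnedAvg_erase_sub_le {g : Finset α → ℝ} {B : ℝ} (hB : 0 ≤ B) {S : Finset α}
    {c k : ℕ} (hS : S.card = k + 1) (hc : c < k)
    (hg : ∀ W ∈ powersetCard (c + 1) S, |g W| ≤ B) :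
    ∑ a ∈ S, |pinnedAvg g c (S.erase a) a - sliceAvg (S.erase a) (c + 1) g| ≤
      B * (k + 1) * √((k : ℝ) + 1) / √k * (1 / √((c : ℝ) + 1) + 1 / √((k : ℝ) - c)) := by
  have hck : (0 : ℝ) < k - c := by
    have : (c : ℝ) < k := by exact_mod_cast hc
    linarith
  have hk0 : (0 : ℝ) < k := by exact_mod_cast (by omega : 0 < k)
  have h1 : ∀ a ∈ S, |pinnedAvg g c (S.erase a) a - sliceAvg (S.erase a) (c + 1) g| =
      (k + 1) / (k - c) * |pinnedAvg g c (S.erase a) a - sliceAvg S (c + 1) g| := by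
    intro a ha
    have h := sliceAvg_succ_eq (show c < S.card by omega) g ha
    rw [← abs_of_pos (div_pos (by positivity : (0 : ℝ) < k + 1) hck), ← abs_mul]
    congr 1
    rw [hS] at h
    push_cast at h
    rw [pinnedAvg, div_mul_eq_mul_div, eq_div_iff hck.ne']
    linear_combination h
  rw [sum_congr rfl h1, ← mul_sum]
  have h2 := sum_sliceAvg_insert_sub_sq_le (show c < S.card by omega) hg
  have h3 := sum_abs_le_sqrt_mul_sqrt S
    (fun a => pinnedAvg g c (S.erase a) a - sliceAvg S (c + 1) g)
  have h4 := h3.trans (mul_le_mul_of_nonneg_left (Real.sqrt_le_sqrt h2) (Real.sqrt_nonneg _))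
  refine (mul_le_mul_of_nonneg_left h4 (by positivity)).trans ?_
  rw [Real.sqrt_mul (sq_nonneg _), Real.sqrt_sq hB, hS]
  push_cast
  rw [show (k : ℝ) + 1 - (c + 1) = k - c by ring, show (k : ℝ) + 1 - 1 = k by ring,
    Real.sqrt_div (by positivity), Real.sqrt_mul (by positivity), Real.sqrt_mul (by positivity)]
  set u := √((c : ℝ) + 1) with hu
  set v := √((k : ℝ) - c) with hv
  set w := √((k : ℝ) + 1) with hw
  set z := √(k : ℝ) with hz
  have hu0 : 0 < u := Real.sqrt_pos.2 (by positivity)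
  have hv0 : 0 < v := Real.sqrt_pos.2 hck
  have hw0 : 0 < w := Real.sqrt_pos.2 (by positivity)
  have hz0 : 0 < z := Real.sqrt_pos.2 hk0
  have hu2 : u ^ 2 = c + 1 := Real.sq_sqrt (by positivity)
  have hv2 : v ^ 2 = k - c := Real.sq_sqrt hck.le
  have hw2 : w ^ 2 = k + 1 := Real.sq_sqrt (by positivity)
  -- Since `u ^ 2 + v ^ 2 = w ^ 2`; this splits `w / (u * v)` into two inverse square roots, each
  -- summable over `c`.
  have huvw : w ≤ u + v := by
    refine (pow_le_pow_iff_left₀ hw0.le (by positivity) two_ne_zero).1 ?_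
    nlinarith
  rw [← hv2, ← hw2]
  calc _ = B * w ^ 3 / z * (w / (u * v)) := by field_simp
    _ ≤ B * w ^ 3 / z * ((u + v) / (u * v)) := by gcongr
    _ = _ := by field_simp; ring

theorem sum_layerFlow_erase {k : ℕ} (hk : k + 1 ≤ Fintype.card α) (f : Finset α → ℝ)
    {S : Finset α} (hS : S.card = k + 1) :
    ∑ a ∈ S, layerFlow k f (S.erase a) a = f S - supersetAvg (k + 1) f ∅ := by
  have hk0 : (0 : ℝ) < k + 1 := by positivity
  refine mul_left_cancel₀ hk0.ne' ?_
  have h1 : ∀ a ∈ S, ((k : ℝ) + 1) * layerFlow k f (S.erase a) a =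
      f S - supersetAvg (k + 1) f ∅ + ∑ c ∈ range k, (N - k) / (N - c) *
        (pinnedAvg (supersetAvg (k + 1) f) c (S.erase a) a -
          sliceAvg (S.erase a) (c + 1) (supersetAvg (k + 1) f)) := by
    intro a ha
    rw [layerFlow_eq hk f (by rw [card_erase_of_mem ha]; omega) (notMem_erase a S),
      insert_erase ha]
  rw [mul_sum, sum_congr rfl h1, sum_add_distrib, sum_comm, sum_const, hS, nsmul_eq_mul]
  rw [sum_eq_zero (s := range k)]
  · push_cast; ring
  · intro c hc
    have := mem_range.1 hc
    rw [← mul_sum, sum_pinnedAvg_erase_sub _ (by omega), mul_zero]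

/-- In the formula of `layerFlow_eq`, `f S` minus its mean contributes 2 to the constant and the two
sums of inverse square roots contribute 4. -/
theorem sum_abs_layerFlow_upper_le {k : ℕ} (hk : k + 1 ≤ Fintype.card α)
    {f : Finset α → ℝ} {B : ℝ} (hB : 0 ≤ B) (hf : ∀ S : Finset α, S.card = k + 1 → |f S| ≤ B)
    {S : Finset α} (hS : S.card = k + 1) :
    ∑ a ∈ S, |layerFlow k f (S.erase a) a| ≤ 6 * B * √((k : ℝ) + 1) := by
  have hN : ((k : ℝ) + 1) ≤ N := by exact_mod_cast hk
  have hk0 : (0 : ℝ) < k + 1 := by positivity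
  refine le_of_mul_le_mul_left ?_ hk0
  have hg : ∀ C : Finset α, C.card ≤ k + 1 → |supersetAvg (k + 1) f C| ≤ B :=
    fun C hC => abs_supersetAvg_le hB hf hC
  have h1 : ∀ a ∈ S, ((k : ℝ) + 1) * |layerFlow k f (S.erase a) a| ≤
      2 * B + ∑ c ∈ range k, |pinnedAvg (supersetAvg (k + 1) f) c (S.erase a) a -
          sliceAvg (S.erase a) (c + 1) (supersetAvg (k + 1) f)| := by
    intro a ha
    have e : ∀ x : ℝ, ((k : ℝ) + 1) * |x| = |((k : ℝ) + 1) * x| := fun x => by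
      rw [abs_mul, abs_of_pos hk0]
    rw [e, layerFlow_eq hk f (by rw [card_erase_of_mem ha]; omega) (notMem_erase a S), insert_erase ha]
    refine (abs_add_le _ _).trans (add_le_add ?_ ?_)
    · refine (abs_sub _ _).trans ?_
      linarith [hf S hS, hg ∅ (by simp)]
    · refine (abs_sum_le_sum_abs _ _).trans (sum_le_sum fun c hc => ?_)
      have hc' : (c : ℝ) < k := by exact_mod_cast mem_range.1 hc
      rw [abs_mul, abs_of_pos (div_pos (by linarith) (by linarith))]
      exact mul_le_of_le_one_left (abs_nonneg _) (div_le_one_of_le₀ (by linarith) (by linarith))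
  rw [mul_sum]
  refine (sum_le_sum h1).trans ?_
  rw [sum_add_distrib, sum_comm, sum_const, hS, nsmul_eq_mul]
  have h2 : ∀ c ∈ range k, ∑ a ∈ S, |pinnedAvg (supersetAvg (k + 1) f) c (S.erase a) a -
      sliceAvg (S.erase a) (c + 1) (supersetAvg (k + 1) f)| ≤
      B * (k + 1) * √((k : ℝ) + 1) / √k * (1 / √((c : ℝ) + 1) + 1 / √((k : ℝ) - c)) := by
    intro c hc
    have hc := mem_range.1 hc
    refine sum_abs_pinnedAvg_erase_sub_le hB hS hc fun W hW => hg W ?_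
    rw [(mem_powersetCard.1 hW).2]; omega
  have h3 := sum_le_sum h2
  rw [← mul_sum, sum_add_distrib] at h3
  have h4 : B * (k + 1) * √((k : ℝ) + 1) / √k * (∑ c ∈ range k, 1 / √((c : ℝ) + 1) +
      ∑ c ∈ range k, 1 / √((k : ℝ) - c)) ≤ 4 * B * (k + 1) * √((k : ℝ) + 1) := by
    rcases Nat.eq_zero_or_pos k with rfl | hkpos
    · simp; positivity
    have hz : 0 < √(k : ℝ) := Real.sqrt_pos.2 (by exact_mod_cast hkpos)
    calc _ ≤ B * (k + 1) * √((k : ℝ) + 1) / √k * (2 * √k + 2 * √k) := by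
          gcongr
          · exact sum_sqrt_inv_le k
          · exact sum_sqrt_inv_reflect_le k
      _ = _ := by field_simp; ring
  have h5 : 1 ≤ √((k : ℝ) + 1) := Real.one_le_sqrt.2 (by linarith [(Nat.cast_nonneg k : (0 : ℝ) ≤ k)])
  have h6 : B * (k + 1) * 1 ≤ B * (k + 1) * √((k : ℝ) + 1) :=
    mul_le_mul_of_nonneg_left h5 (by positivity)
  push_cast
  linarith

end Flow

/-! ### Boundary estimates within a layer and between adjacent layers. -/

section Layers

variable {α : Type*} [DecidableEq α]

/-- `ℬ` contains the vertex boundary of `𝒜` in the graph of the sets of size at most `R`. -/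
def CoversBoundary (R : ℕ) (𝒜 ℬ : Finset (Finset α)) : Prop :=
  ∀ T : Finset α, ∀ a ∉ T, T.card + 1 ≤ R →
    (insert a T ∈ 𝒜 → T ∉ 𝒜 → T ∈ ℬ) ∧ (T ∈ 𝒜 → insert a T ∉ 𝒜 → insert a T ∈ ℬ)

variable [Fintype α]

local notation "N" => (Fintype.card α : ℝ)

theorem sum_powersetCard_indicator_mul (𝒜 : Finset (Finset α)) (k : ℕ) (F : Finset α → ℝ) :
    ∑ S ∈ powersetCard k univ, (if S ∈ 𝒜 then 1 else 0) * F S = ∑ S ∈ 𝒜.slice k, F S := by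
  simp only [ite_mul, one_mul, zero_mul]
  rw [← sum_filter]
  refine sum_congr ?_ fun _ _ => rfl
  ext S
  simp [mem_slice, mem_powersetCard, and_comm]

/-- In the net flow into `𝒜` an edge survives only if exactly one end is in `𝒜`. The other end is
then in `ℬ`, and the edge is charged to it. -/
theorem CoversBoundary.sum_slice_le {R : ℕ} {𝒜 ℬ : Finset (Finset α)}
    (h : CoversBoundary R 𝒜 ℬ) {k : ℕ} (hk : k + 1 ≤ R) {θ : Finset α → α → ℝ} {D₁ D₂ : ℝ}
    (h₁ : ∀ T : Finset α, T.card = k → ∑ a ∈ Tᶜ, |θ T a| ≤ D₁)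
    (h₂ : ∀ S : Finset α, S.card = k + 1 → ∑ a ∈ S, |θ (S.erase a) a| ≤ D₂) :
    ∑ S ∈ 𝒜.slice (k + 1), ∑ a ∈ S, θ (S.erase a) a - ∑ T ∈ 𝒜.slice k, ∑ a ∈ Tᶜ, θ T a ≤
      D₁ * (ℬ.slice k).card + D₂ * (ℬ.slice (k + 1)).card := by
  have key : ∀ (𝒞 : Finset (Finset α)) (η : Finset α → α → ℝ),
      ∑ S ∈ 𝒞.slice (k + 1), ∑ a ∈ S, η (S.erase a) a =
        ∑ T ∈ powersetCard k univ, ∑ a ∈ Tᶜ, (if insert a T ∈ 𝒞 then 1 else 0) * η T a := by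
    intro 𝒞 η
    rw [← sum_powersetCard_indicator_mul]
    have := sum_powersetCard_succ_sum_erase' (univ : Finset α) k
      (fun T a => (if insert a T ∈ 𝒞 then 1 else 0) * η T a)
    simp only [← compl_eq_univ_sdiff] at this
    rw [← this]
    refine sum_congr rfl fun S _ => ?_
    rw [mul_sum]
    exact sum_congr rfl fun a ha => by rw [insert_erase ha]
  have e₁ : ∑ T ∈ ℬ.slice k, ∑ a ∈ Tᶜ, |θ T a| ≤ D₁ * (ℬ.slice k).card := by
    rw [mul_comm, ← nsmul_eq_mul, ← sum_const]
    exact sum_le_sum fun T hT => h₁ T (mem_slice.1 hT).2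
  have e₂ : ∑ S ∈ ℬ.slice (k + 1), ∑ a ∈ S, |θ (S.erase a) a| ≤
      D₂ * (ℬ.slice (k + 1)).card := by
    rw [mul_comm, ← nsmul_eq_mul, ← sum_const]
    exact sum_le_sum fun T hT => h₂ T (mem_slice.1 hT).2
  refine le_trans ?_ (add_le_add e₁ e₂)
  rw [key 𝒜 θ, key ℬ fun T a => |θ T a|, ← sum_powersetCard_indicator_mul 𝒜 k,
    ← sum_powersetCard_indicator_mul ℬ k, ← sum_sub_distrib, ← sum_add_distrib]
  refine sum_le_sum fun T hT => ?_
  rw [mul_sum, mul_sum, ← sum_sub_distrib, ← sum_add_distrib]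
  refine sum_le_sum fun a ha => ?_
  obtain ⟨hlow, hup⟩ := h T a (mem_compl.1 ha) (by rw [(mem_powersetCard.1 hT).2]; exact hk)
  have hn := neg_abs_le (θ T a)
  have hl := le_abs_self (θ T a)
  have h0 := abs_nonneg (θ T a)
  by_cases hT𝒜 : T ∈ 𝒜 <;> by_cases hS𝒜 : insert a T ∈ 𝒜
  · simp only [hT𝒜, hS𝒜, if_true]
    split_ifs <;> linarith
  · simp only [hT𝒜, hS𝒜, hup hT𝒜 hS𝒜, if_true, if_false]
    split_ifs <;> linarith
  · simp only [hT𝒜, hS𝒜, hlow hS𝒜 hT𝒜, if_true, if_false]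
    split_ifs <;> linarith
  · simp only [hT𝒜, hS𝒜, if_false]
    split_ifs <;> linarith

/-- The variance of the indicator of a family inside the layer `k + 1` is controlled by the part
of its boundary in the layers `k` and `k + 1`. -/
theorem CoversBoundary.variance_slice_le {R : ℕ} {𝒜 ℬ : Finset (Finset α)}
    (h : CoversBoundary R 𝒜 ℬ) {k : ℕ} (hk : k + 1 ≤ R) (hR : R ≤ Fintype.card α) :
    ((𝒜.slice (k + 1)).card : ℝ) *
        (1 - (𝒜.slice (k + 1)).card / ((Fintype.card α).choose (k + 1) : ℝ)) ≤
      2 * (N - k) / √((k : ℝ) + 1) * (ℬ.slice k).card +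
        3 * √((k : ℝ) + 1) * (ℬ.slice (k + 1)).card := by
  have hkn : k + 1 ≤ Fintype.card α := hk.trans hR
  -- The shift by 1/2 leaves `f` minus its mean unchanged and halves the sup bound.
  set f : Finset α → ℝ := fun S => (if S ∈ 𝒜 then 1 else 0) - 1 / 2 with hf
  have hfb : ∀ S : Finset α, S.card = k + 1 → |f S| ≤ 1 / 2 := by
    intro S _
    simp only [hf]
    split_ifs <;> norm_num [abs_le]
  have hcut := h.sum_slice_le hk (θ := layerFlow k f)
    (fun T hT => sum_abs_layerFlow_lower_le hkn (by norm_num) hfb hT)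
    (fun S hS => sum_abs_layerFlow_upper_le hkn (by norm_num) hfb hS)
  have hp : (0 : ℝ) < (Fintype.card α).choose (k + 1) := by
    exact_mod_cast Nat.choose_pos hkn
  have hmean : supersetAvg (k + 1) f ∅ =
      (𝒜.slice (k + 1)).card / ((Fintype.card α).choose (k + 1) : ℝ) - 1 / 2 := by
    have := sum_powersetCard_indicator_mul 𝒜 (k + 1) (fun _ => 1)
    simp only [mul_one, sum_const, nsmul_eq_mul] at this
    simp only [supersetAvg, sliceAvg, hf, sum_sub_distrib, empty_union, compl_empty, card_empty,
      Nat.sub_zero, sum_const, card_powersetCard, nsmul_eq_mul, card_univ]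
    rw [this]
    field_simp
  have hdiv : ∀ S ∈ 𝒜.slice (k + 1), ∑ a ∈ S, layerFlow k f (S.erase a) a =
      1 - (𝒜.slice (k + 1)).card / ((Fintype.card α).choose (k + 1) : ℝ) := by
    intro S hS
    rw [mem_slice] at hS
    rw [sum_layerFlow_erase hkn f hS.2, hmean]
    simp only [hf, hS.1, if_true]
    ring
  rw [sum_congr rfl hdiv, sum_const, nsmul_eq_mul,
    sum_eq_zero (s := 𝒜.slice k) fun T _ => sum_layerFlow k f T, sub_zero] at hcut
  refine hcut.trans (le_of_eq ?_)
  ring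

/-- The densities of a family in two consecutive layers differ by at most the part of its
boundary in these layers. -/
theorem CoversBoundary.density_sub_le {R : ℕ} {𝒜 ℬ : Finset (Finset α)}
    (h : CoversBoundary R 𝒜 ℬ) {k : ℕ} (hk : k + 1 ≤ R) (hR : 2 * R ≤ Fintype.card α) :
    ((Fintype.card α).choose k : ℝ) *
        |(𝒜.slice k).card / ((Fintype.card α).choose k : ℝ) -
          (𝒜.slice (k + 1)).card / ((Fintype.card α).choose (k + 1) : ℝ)| ≤
      (ℬ.slice k).card + (ℬ.slice (k + 1)).card := by
  set w : ℝ := (((Fintype.card α).choose k : ℕ) : ℝ) with hw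
  set w' : ℝ := (((Fintype.card α).choose (k + 1) : ℕ) : ℝ) with hw'
  set x : ℝ := ((𝒜.slice k).card : ℝ) with hx
  set x' : ℝ := ((𝒜.slice (k + 1)).card : ℝ) with hx'
  set b : ℝ := ((ℬ.slice k).card : ℝ) with hb
  set b' : ℝ := ((ℬ.slice (k + 1)).card : ℝ) with hb'
  have hwp : 0 < w := by rw [hw]; exact_mod_cast Nat.choose_pos (by omega)
  have hwp' : 0 < w' := by rw [hw']; exact_mod_cast Nat.choose_pos (by omega)
  have hkn : (k : ℝ) + 1 ≤ N - k := by
    have : ((2 * k + 1 : ℕ) : ℝ) ≤ N := by exact_mod_cast (by omega)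
    push_cast at this; linarith
  have hk1 : (0 : ℝ) < k + 1 := by positivity
  have hm : 0 < N - k := by linarith
  have hb0 : 0 ≤ b' := Nat.cast_nonneg _
  have hww : w' * (k + 1) = w * (N - k) := by
    rw [hw, hw', ← Nat.cast_sub (by omega)]
    exact_mod_cast Nat.choose_succ_right_eq (Fintype.card α) k
  -- Constant flows in the two directions give the two signs of the absolute value.
  have hcut : ∀ ε : ℝ, |ε| = 1 →
      ε * ((k + 1) * x' - (N - k) * x) ≤ (N - k) * b + (k + 1) * b' := by
    intro ε hε
    have hc : ∀ T : Finset α, T.card = k → (Tᶜ.card : ℝ) = N - k := by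
      intro T hT
      rw [card_compl, hT, Nat.cast_sub (by omega)]
    have := h.sum_slice_le hk (θ := fun _ _ => ε) (D₁ := N - k) (D₂ := k + 1)
      (fun T hT => by simp [hε, hc T hT]) (fun S hS => by simp [hε, hS])
    refine le_trans (le_of_eq ?_) this
    have e1 : ∑ S ∈ 𝒜.slice (k + 1), ∑ a ∈ S, ε = ∑ S ∈ 𝒜.slice (k + 1), (k + 1) * ε :=
      sum_congr rfl fun S hS => by
        rw [sum_const, (mem_slice.1 hS).2, nsmul_eq_mul]; push_cast; rfl
    have e2 : ∑ T ∈ 𝒜.slice k, ∑ a ∈ Tᶜ, ε = ∑ T ∈ 𝒜.slice k, (N - k) * ε :=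
      sum_congr rfl fun T hT => by
        rw [sum_const, nsmul_eq_mul, hc T (mem_slice.1 hT).2]
    rw [e1, e2, sum_const, sum_const, nsmul_eq_mul, nsmul_eq_mul]
    ring
  have h1 := hcut 1 (by simp)
  have h2 := hcut (-1) (by simp)
  have h3 : w * (x / w - x' / w') * (N - k) = (N - k) * x - (k + 1) * x' := by
    field_simp
    linear_combination x' * hww
  have h4 : (k + 1) * b' ≤ (N - k) * b' := mul_le_mul_of_nonneg_right hkn hb0
  refine le_of_mul_le_mul_right ?_ hm
  have h5 : w * |x / w - x' / w'| * (N - k) = |w * (x / w - x' / w') * (N - k)| := by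
    rw [abs_mul, abs_mul, abs_of_pos hwp, abs_of_pos hm]
  rw [h5, h3, abs_le]
  constructor <;> nlinarith

end Layers

/-! ### Partial sums of binomial coefficients. -/

section Binomial

theorem four_pow_sq_le_mul_centralBinom_sq {m : ℕ} (hm : 1 ≤ m) :
    (4 ^ m) ^ 2 ≤ 4 * m * m.centralBinom ^ 2 := by
  induction m, hm using Nat.le_induction with
  | base => decide
  | succ m hm ih =>
    have h := Nat.succ_mul_centralBinom_succ m
    refine Nat.le_of_mul_le_mul_left ?_ (show 0 < m * (m + 1) by positivity)
    calc m * (m + 1) * (4 ^ (m + 1)) ^ 2 = 16 * (m * (m + 1)) * (4 ^ m) ^ 2 := by ring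
      _ ≤ 16 * (m * (m + 1)) * (4 * m * m.centralBinom ^ 2) := Nat.mul_le_mul_left _ ih
      _ = 16 * m * m.centralBinom ^ 2 * (4 * m * (m + 1)) := by ring
      _ ≤ 16 * m * m.centralBinom ^ 2 * (2 * m + 1) ^ 2 := by gcongr; nlinarith
      _ = 4 * m * (2 * (2 * m + 1) * m.centralBinom) ^ 2 := by ring
      _ = 4 * m * ((m + 1) * (m + 1).centralBinom) ^ 2 := by rw [h]
      _ = m * (m + 1) * (4 * (m + 1) * (m + 1).centralBinom ^ 2) := by ring

theorem two_pow_sq_le_mul_choose_half_sq {n : ℕ} (hn : 1 ≤ n) :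
    (2 ^ n) ^ 2 ≤ 4 * n * (n.choose (n / 2)) ^ 2 := by
  obtain ⟨m, rfl | rfl⟩ := n.even_or_odd'
  · have h := four_pow_sq_le_mul_centralBinom_sq (m := m) (by omega)
    rw [Nat.mul_div_cancel_left _ two_pos, pow_mul, ← Nat.centralBinom_eq_two_mul_choose]
    refine h.trans ?_
    gcongr
    omega
  · have h := four_pow_sq_le_mul_centralBinom_sq (m := m + 1) (by omega)
    have e : (m + 1).centralBinom = 2 * (2 * m + 1).choose m := by
      rw [Nat.centralBinom_eq_two_mul_choose, show 2 * (m + 1) = 2 * m + 1 + 1 by ring,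
        Nat.choose_succ_succ, Nat.succ_eq_add_one, Nat.choose_symm_half]
      ring
    rw [show (2 * m + 1) / 2 = m by omega]
    rw [e] at h
    have h4 : (4 : ℕ) ^ (m + 1) = 2 * 2 ^ (2 * m + 1) := by
      rw [pow_succ 2, pow_mul, pow_succ]; norm_num; ring
    rw [h4] at h
    have : 4 * (m + 1) * (2 * (2 * m + 1).choose m) ^ 2 ≤
        4 * (4 * (2 * m + 1) * (2 * m + 1).choose m ^ 2) := by
      calc _ = 16 * (2 * m + 1).choose m ^ 2 * (m + 1) := by ring
        _ ≤ 16 * (2 * m + 1).choose m ^ 2 * (2 * m + 1) := by gcongr; omega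
        _ = _ := by ring
    linarith [h.trans this, mul_pow 2 (2 ^ (2 * m + 1)) 2]

/-- The ratios satisfy `q (j + 1) = 1 + (j + 1) / (n - j) * q j`, with coefficients increasing in
`j`. -/
theorem sum_choose_div_choose_mono {n i : ℕ} (hi : i + 1 ≤ n) :
    (∑ k ∈ range (i + 1), (n.choose k : ℝ)) / n.choose i ≤
      (∑ k ∈ range (i + 2), (n.choose k : ℝ)) / n.choose (i + 1) := by
  have hpos : ∀ j ≤ n, (0 : ℝ) < n.choose j := fun j hj => by exact_mod_cast Nat.choose_pos hj
  have hratio : ∀ j, j + 1 ≤ n →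
      (n.choose j : ℝ) / n.choose (j + 1) = (j + 1) / (n - j) := by
    intro j hj
    have hj' : (0 : ℝ) < n - j := by
      rw [← Nat.cast_sub (by omega)]; exact_mod_cast (by omega : 0 < n - j)
    rw [div_eq_div_iff (hpos _ hj).ne' hj'.ne', ← Nat.cast_sub (by omega), mul_comm (_ + 1)]
    exact_mod_cast (Nat.choose_succ_right_eq n j).symm
  have hstep : ∀ j, j + 1 ≤ n → (∑ k ∈ range (j + 2), (n.choose k : ℝ)) / n.choose (j + 1) =
      1 + (j + 1) / (n - j) * ((∑ k ∈ range (j + 1), (n.choose k : ℝ)) / n.choose j) := by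
    intro j hj
    have h1 := (hpos _ hj).ne'
    have h2 := (hpos j (by omega)).ne'
    rw [sum_range_succ _ (j + 1), ← hratio j hj]
    field_simp
    ring
  induction i with
  | zero => rw [hstep 0 hi]; simp
  | succ i ih =>
    have ih := ih (by omega)
    rw [hstep (i + 1) hi]
    nth_rewrite 1 [hstep i (by omega)]
    have hi' : ((i : ℝ) + 1) + 1 ≤ n := by exact_mod_cast hi
    have h0 : 0 ≤ (∑ k ∈ range (i + 1), (n.choose k : ℝ)) / n.choose i := by positivity
    push_cast
    refine add_le_add_right (mul_le_mul ?_ ih h0 (div_nonneg (by positivity) (by linarith))) _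
    exact div_le_div₀ (by positivity) (by linarith) (by linarith) (by linarith)

/-- By monotonicity of the ratio it suffices to treat the middle layer, where the sum is at most `2
^ n`. -/
theorem sum_choose_le_sqrt_mul_choose {n i : ℕ} (hn : 1 ≤ n) (hi : 2 * i ≤ n) :
    ∑ k ∈ range (i + 1), (n.choose k : ℝ) ≤ 2 * √n * n.choose i := by
  have hpos : ∀ j ≤ n, (0 : ℝ) < n.choose j := fun j hj => by exact_mod_cast Nat.choose_pos hj
  rw [← div_le_iff₀ (hpos i (by omega))]
  have hmono : ∀ j, i ≤ j → j ≤ n →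
      (∑ k ∈ range (i + 1), (n.choose k : ℝ)) / n.choose i ≤
        (∑ k ∈ range (j + 1), (n.choose k : ℝ)) / n.choose j := by
    intro j hij
    induction j, hij using Nat.le_induction with
    | base => exact fun _ => le_rfl
    | succ j _ ih => exact fun hj => (ih (by omega)).trans (sum_choose_div_choose_mono hj)
  refine (hmono (n / 2) (by omega) (by omega)).trans ?_
  rw [div_le_iff₀ (hpos _ (by omega))]
  have h1 : ∑ k ∈ range (n / 2 + 1), (n.choose k : ℝ) ≤ 2 ^ n := by
    have h : (∑ k ∈ range (n + 1), (n.choose k : ℝ)) = 2 ^ n := by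
      exact_mod_cast Nat.sum_range_choose n
    rw [← h]
    exact sum_le_sum_of_subset_of_nonneg (range_subset_range.2 (by omega))
      fun _ _ _ => Nat.cast_nonneg _
  refine h1.trans ((pow_le_pow_iff_left₀ (by positivity) (by positivity) two_ne_zero).1 ?_)
  rw [mul_pow, mul_pow, Real.sq_sqrt (Nat.cast_nonneg _)]
  norm_num
  exact_mod_cast two_pow_sq_le_mul_choose_half_sq hn

end Binomial

/-! ### Decomposition of the variance over layers. -/

section Variance

theorem sum_mul_abs_sub_last_le (R : ℕ) {w : ℕ → ℝ} (hw : ∀ k, 0 ≤ w k) (d : ℕ → ℝ) :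
    ∑ k ∈ range (R + 1), w k * |d k - d R| ≤
      ∑ i ∈ range R, (∑ k ∈ range (i + 1), w k) * |d i - d (i + 1)| := by
  induction R with
  | zero => simp
  | succ R ih =>
    rw [sum_range_succ _ (R + 1), sub_self, abs_zero, mul_zero, add_zero,
      sum_range_succ (fun i => (∑ k ∈ range (i + 1), w k) * |d i - d (i + 1)|) R, sum_mul]
    refine le_trans ?_ (add_le_add_left ih _)
    rw [← sum_add_distrib]
    refine sum_le_sum fun k _ => ?_
    rw [← mul_add]
    exact mul_le_mul_of_nonneg_left (abs_sub_le _ _ _) (hw k)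

/-- The variance is at most the sum of the variances inside the layers and the mean deviation of
the densities of the layers. -/
theorem variance_le_within_add_between {ι : Type*} {s : Finset ι} {w x : ι → ℝ} {c : ℝ}
    (hw : ∀ k ∈ s, 0 < w k) (hx : ∀ k ∈ s, 0 ≤ x k) (hxw : ∀ k ∈ s, x k ≤ w k)
    (hc0 : 0 ≤ c) (hc1 : c ≤ 1) (hW : 0 < ∑ k ∈ s, w k) :
    (∑ k ∈ s, x k) * (∑ k ∈ s, w k - ∑ k ∈ s, x k) / ∑ k ∈ s, w k ≤
      ∑ k ∈ s, x k * (1 - x k / w k) + ∑ k ∈ s, w k * |x k / w k - c| := by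
  set a := ∑ k ∈ s, x k with ha
  set W := ∑ k ∈ s, w k with hWdef
  -- The left side is the sum over layer `k` of (indicator - c)²; densities and `c` lie in [0, 1],
  -- so the squared deviation is at most the absolute one.
  have hterm : ∀ k ∈ s, x k - 2 * c * x k + c ^ 2 * w k ≤
      x k * (1 - x k / w k) + w k * |x k / w k - c| := by
    intro k hk
    have hwk := hw k hk
    set d := x k / w k with hd
    have hxd : x k = w k * d := by rw [hd]; field_simp
    have hd0 : 0 ≤ d := div_nonneg (hx k hk) hwk.le
    have hd1 : d ≤ 1 := div_le_one_of_le₀ (hxw k hk) hwk.le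
    have h1 : (d - c) ^ 2 ≤ |d - c| := by
      rw [← sq_abs]
      have : |d - c| ≤ 1 := abs_le.2 ⟨by linarith, by linarith⟩
      nlinarith [abs_nonneg (d - c)]
    rw [hxd]
    nlinarith [mul_le_mul_of_nonneg_left h1 hwk.le]
  have hsum := sum_le_sum hterm
  rw [sum_add_distrib, sum_add_distrib, sum_sub_distrib, ← mul_sum, ← mul_sum, ← ha, ← hWdef]
    at hsum
  refine le_trans ?_ hsum
  rw [div_le_iff₀ hW]
  nlinarith [sq_nonneg (a - c * W)]

end Variance

/-! ### Assembly of the isoperimetric inequality. -/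

section Isoperimetry

variable {α : Type*} [DecidableEq α] [Fintype α]

omit [DecidableEq α] [Fintype α] in
theorem card_eq_sum_card_slice {R : ℕ} {𝒜 : Finset (Finset α)} (h : ∀ S ∈ 𝒜, S.card ≤ R) :
    𝒜.card = ∑ k ∈ range (R + 1), (𝒜.slice k).card :=
  card_eq_sum_card_fiberwise fun S hS => by
    have := h S hS
    simp only [coe_range, Set.mem_Iio]
    omega

omit [Fintype α] in
theorem sum_card_slice_le (s : Finset ℕ) (ℬ : Finset (Finset α)) :
    ∑ k ∈ s, (ℬ.slice k).card ≤ ℬ.card := by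
  rw [← card_biUnion]
  · refine card_le_card fun S hS => ?_
    obtain ⟨k, -, hk⟩ := mem_biUnion.1 hS
    exact (mem_slice.1 hk).1
  · intro i _ j _ hij
    refine disjoint_left.2 fun S hi hj => hij ((mem_slice.1 hi).2.symm.trans (mem_slice.1 hj).2)

local notation "N" => (Fintype.card α : ℝ)

theorem CoversBoundary.le_card {R : ℕ} {𝒜 ℬ : Finset (Finset α)} (h : CoversBoundary R 𝒜 ℬ)
    (hR : 2 * R ≤ Fintype.card α) (h𝒜 : ∀ S ∈ 𝒜, S.card ≤ R) (hn : 1 ≤ Fintype.card α)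
    {ρ M : ℝ} (hρ0 : 0 < ρ) (hρ : ρ < 1 / 2)
    (hM₁ : M ≤ 𝒜.card)
    (hM₂ : M ≤ ∑ k ∈ range (R + 1), ((Fintype.card α).choose k : ℝ) - 𝒜.card)
    (hM : ∑ k ∈ range (⌊ρ * N⌋₊ + 1), ((Fintype.card α).choose k : ℝ) ≤ M) :
    √ρ ^ 3 / (18 * √N) * M ≤ ℬ.card := by
  set w : ℕ → ℝ := fun k => ((Fintype.card α).choose k : ℝ) with hw
  set x : ℕ → ℝ := fun k => ((𝒜.slice k).card : ℝ) with hx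
  set b : ℕ → ℝ := fun k => ((ℬ.slice k).card : ℝ) with hb
  set s := √ρ with hs
  set r := √N with hr
  have hN1 : (1 : ℝ) ≤ N := by exact_mod_cast hn
  have hs0 : 0 < s := Real.sqrt_pos.2 hρ0
  have hr0 : 0 < r := Real.sqrt_pos.2 (by linarith)
  have hs2 : s ^ 2 = ρ := Real.sq_sqrt hρ0.le
  have hr2 : r ^ 2 = N := Real.sq_sqrt (by linarith)
  have hwpos : ∀ k ∈ range (R + 1), 0 < w k := fun k hk => by
    have := mem_range.1 hk
    exact Nat.cast_pos.2 (Nat.choose_pos (by omega))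
  have hxw : ∀ k, x k ≤ w k := fun k => by
    have := (sized_slice (𝒜 := 𝒜) (r := k)).card_le
    exact Nat.cast_le.2 this
  have hx0 : ∀ k, 0 ≤ x k := fun k => Nat.cast_nonneg _
  have hb0 : ∀ k, 0 ≤ b k := fun k => Nat.cast_nonneg _
  have hw0 : ∀ k, 0 ≤ w k := fun k => Nat.cast_nonneg _
  have ha : (𝒜.card : ℝ) = ∑ k ∈ range (R + 1), x k := by
    rw [card_eq_sum_card_slice h𝒜]; push_cast; rfl
  have hbsum : ∀ t : Finset ℕ, ∑ k ∈ t, b k ≤ ℬ.card := fun t => by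
    have := sum_card_slice_le t ℬ
    simp only [hb]
    exact_mod_cast this
  have hb2 : ∑ j ∈ range R, (b j + b (j + 1)) ≤ 2 * ℬ.card := by
    rw [sum_add_distrib]
    have h1 := hbsum (range R)
    have h2 := hbsum (range (R + 1))
    rw [sum_range_succ'] at h2
    linarith [hb0 0]
  set a : ℝ := (𝒜.card : ℝ) with hadef
  set W := ∑ k ∈ range (R + 1), w k with hWdef
  -- `η` is `2 * N / √(ρ * N)`, a common bound for both flow coefficients in the layers above `ρ *
  -- N`.
  set η := 2 * r / s with hη
  have hη0 : 0 ≤ η := by positivity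
  have hWpos : 0 < W := sum_pos hwpos ⟨0, by simp⟩
  have hwithin : ∑ k ∈ range (R + 1), x k * (1 - x k / w k) ≤ M / 4 + η * (2 * ℬ.card) := by
    set K := ⌊ρ * N⌋₊ with hK
    have hquarter : ∀ k ∈ range (R + 1), x k * (1 - x k / w k) ≤ w k / 4 := by
      intro k hk
      have hwk := hwpos k hk
      have : x k * (1 - x k / w k) = w k * (x k / w k * (1 - x k / w k)) := by field_simp
      rw [this]
      nlinarith [sq_nonneg (x k / w k - 1 / 2)]
    have hlow : ∑ k ∈ range (R + 1), (if k ≤ K then w k / 4 else 0) ≤ M / 4 := by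
      rw [← sum_filter, ← sum_div]
      refine div_le_div_of_nonneg_right (le_trans ?_ hM) (by norm_num)
      refine sum_le_sum_of_subset_of_nonneg (fun k hk => ?_) fun k _ _ => hw0 k
      have := (mem_filter.1 hk).2
      exact mem_range.2 (by omega)
    have hterm : ∀ j ∈ range R, x (j + 1) * (1 - x (j + 1) / w (j + 1)) ≤
        (if j + 1 ≤ K then w (j + 1) / 4 else 0) + η * (b j + b (j + 1)) := by
      intro j hj
      have hj := mem_range.1 hj
      split_ifs with hjK
      · have := hquarter (j + 1) (mem_range.2 (by omega))
        linarith [mul_nonneg hη0 (add_nonneg (hb0 j) (hb0 (j + 1)))]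
      · have hv := h.variance_slice_le (k := j) (by omega) (by omega)
        have hlt : ρ * N < (j : ℝ) + 1 := by
          exact_mod_cast Nat.lt_of_floor_lt (not_le.1 hjK)
        have hjR : 2 * ((j : ℝ) + 1) ≤ N := by exact_mod_cast (by omega : 2 * (j + 1) ≤ _)
        have hj0 : (0 : ℝ) ≤ j := Nat.cast_nonneg j
        have hsr : s * r ≤ √((j : ℝ) + 1) := by
          refine Real.le_sqrt_of_sq_le ?_
          rw [mul_pow, hs2, hr2]
          exact hlt.le
        have hη₁ : 2 * (N - j) / √((j : ℝ) + 1) ≤ η := by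
          calc _ ≤ 2 * N / (s * r) := by
                refine div_le_div₀ (by positivity) (by linarith) (by positivity) hsr
            _ = η := by rw [hη, ← hr2]; field_simp
        have hη₂ : 3 * √((j : ℝ) + 1) ≤ η := by
          rw [hη, le_div_iff₀ hs0]
          refine (pow_le_pow_iff_left₀ (by positivity) (by positivity) two_ne_zero).1 ?_
          rw [mul_pow, mul_pow, mul_pow, hs2, hr2, Real.sq_sqrt (by positivity)]
          nlinarith
        have := add_le_add (mul_le_mul_of_nonneg_right hη₁ (hb0 j))
          (mul_le_mul_of_nonneg_right hη₂ (hb0 (j + 1)))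
        simp only [hx, hw, hb] at *
        linarith
    -- Layer 0 has no layer below it to carry a flow, but it always counts among the low layers.
    rw [sum_range_succ'] at hlow ⊢
    have h0 := hquarter 0 (by simp)
    have hsum := sum_le_sum hterm
    rw [sum_add_distrib, ← mul_sum] at hsum
    have := mul_le_mul_of_nonneg_left hb2 hη0
    simp only [zero_le, if_true] at hlow
    linarith
  have hbetween : ∑ k ∈ range (R + 1), w k * |x k / w k - x R / w R| ≤
      2 * r * (2 * ℬ.card) := by
    refine (sum_mul_abs_sub_last_le R hw0 (fun k => x k / w k)).trans ?_
    refine le_trans ?_ (mul_le_mul_of_nonneg_left hb2 (by positivity))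
    rw [mul_sum]
    refine sum_le_sum fun j hj => ?_
    have hj := mem_range.1 hj
    have h1 := sum_choose_le_sqrt_mul_choose hn (i := j) (by omega)
    have h2 := h.density_sub_le (k := j) (by omega) hR
    calc _ ≤ 2 * r * w j * |x j / w j - x (j + 1) / w (j + 1)| :=
          mul_le_mul_of_nonneg_right h1 (abs_nonneg _)
      _ = 2 * r * (w j * |x j / w j - x (j + 1) / w (j + 1)|) := by ring
      _ ≤ _ := mul_le_mul_of_nonneg_left h2 (by positivity)
  have hwR := hwpos R (by simp)
  have hvar := variance_le_within_add_between hwpos (fun k _ => hx0 k) (fun k _ => hxw k)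
    (div_nonneg (hx0 R) hwR.le) (div_le_one_of_le₀ (hxw R) hwR.le) hWpos
  rw [← ha, ← hWdef] at hvar
  have hM0 : 0 ≤ M := le_trans (sum_nonneg fun k _ => hw0 k) hM
  -- The larger of `a` and `W - a` is at least `W / 2`.
  have hMvar : M / 2 ≤ a * (W - a) / W := by
    rw [le_div_iff₀ hWpos]
    rcases le_total a (W - a) with hle | hle
    · nlinarith
    · nlinarith
  have hMb : M ≤ (8 * η + 16 * r) * ℬ.card := by linarith
  -- This amounts to `16 * s ^ 2 + 16 * s ^ 3 ≤ 18`; with `s ^ 2 < 1 / 2` and `s ≤ 9 / 10` the left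
  -- side is at most 15.2.
  have hc : 8 * η + 16 * r ≤ 18 * r / s ^ 3 := by
    have hs1 : 10 * s ≤ 10 - 1 := by nlinarith
    rw [hη, le_div_iff₀ (by positivity)]
    have : (8 * (2 * r / s) + 16 * r) * s ^ 3 = r * (16 * s ^ 2 + 16 * s ^ 2 * s) := by
      field_simp
      ring
    have h2 : ρ * s ≤ 1 / 2 * (9 / 10) := by
      exact mul_le_mul hρ.le (by linarith) hs0.le (by norm_num)
    rw [this, hs2, mul_comm]
    exact mul_le_mul_of_nonneg_right (by linarith) hr0.le
  have hfin : M ≤ 18 * r / s ^ 3 * ℬ.card :=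
    hMb.trans (mul_le_mul_of_nonneg_right hc (Nat.cast_nonneg _))
  calc s ^ 3 / (18 * r) * M ≤ s ^ 3 / (18 * r) * (18 * r / s ^ 3 * (ℬ.card : ℝ)) := by gcongr
    _ = (ℬ.card : ℝ) := by field_simp

theorem ncard_hammingBall (n r : ℕ) :
    ((hammingBall n r).ncard : ℝ) = ∑ k ∈ range (r + 1), (n.choose k : ℝ) := by
  have h : hammingBall n r = ((univ.filter fun S : Finset (Fin n) => S.card ≤ r : Finset _) : Set _) := by
    ext S; simp [hammingBall]
  rw [h, Set.ncard_coe_finset, card_eq_sum_card_slice (R := r) (by simp)]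
  push_cast
  refine sum_congr rfl fun k hk => ?_
  have hk := mem_range.1 hk
  have : (univ.filter fun S : Finset (Fin n) => S.card ≤ r).slice k = powersetCard k univ := by
    ext S
    simp only [mem_slice, mem_filter, mem_univ, true_and, mem_powersetCard_univ]
    omega
  rw [this, card_powersetCard, card_univ, Fintype.card_fin]

end Isoperimetry

theorem theorem1 (ρ : ℝ) (hρ : ρ ∈ Set.Ioo (0 : ℝ) (1 / 2)) :
    ∃ n₀ : ℕ, 0 < n₀ ∧
      ∀ n : ℕ, n₀ ≤ n → ∀ R : ℕ, (R : ℝ) ≤ (n : ℝ) / 2 →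
        ∀ A : Set (hammingBall n R),
          ((hammingBall n ⌊ρ * (n : ℝ)⌋₊).ncard : ℝ) ≤ (A.ncard : ℝ) →
          (A.ncard : ℝ) ≤
            ((hammingBall n R).ncard : ℝ) - ((hammingBall n ⌊ρ * (n : ℝ)⌋₊).ncard : ℝ) →
          ρ ^ (3 / 2 : ℝ) / (18 * Real.sqrt (n : ℝ)) *
              min (A.ncard : ℝ) ((Aᶜ : Set (hammingBall n R)).ncard : ℝ) ≤
            (((hammingBallGraph n R).vertexBoundary A).ncard : ℝ) := by
  classical
  -- No estimate is asymptotic, so `n₀ = 1` suffices for every `ρ`.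
  refine ⟨1, one_pos, fun n hn R hR A hA₁ hA₂ => ?_⟩
  have hR' : 2 * R ≤ n := by
    have : ((2 * R : ℕ) : ℝ) ≤ n := by push_cast; linarith
    exact_mod_cast this
  set 𝒜 : Finset (Finset (Fin n)) := A.toFinset.map (Function.Embedding.subtype _) with h𝒜
  set ℬ : Finset (Finset (Fin n)) :=
    ((hammingBallGraph n R).vertexBoundary A).toFinset.map (Function.Embedding.subtype _) with hℬ
  have mem𝒜 : ∀ S (hS : S ∈ hammingBall n R), S ∈ 𝒜 ↔ (⟨S, hS⟩ : hammingBall n R) ∈ A := by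
    intro S hS
    simp [h𝒜, hS]
  have memℬ : ∀ S (hS : S ∈ hammingBall n R),
      S ∈ ℬ ↔ (⟨S, hS⟩ : hammingBall n R) ∈ (hammingBallGraph n R).vertexBoundary A := by
    intro S hS
    simp [hℬ, hS]
  have card𝒜 : A.ncard = 𝒜.card := by rw [card_map, Set.ncard_eq_toFinset_card']
  have cardℬ : ((hammingBallGraph n R).vertexBoundary A).ncard = ℬ.card := by
    rw [card_map, Set.ncard_eq_toFinset_card']
  have hcompl : ((Aᶜ : Set (hammingBall n R)).ncard : ℝ) = (hammingBall n R).ncard - A.ncard := by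
    have := Set.ncard_add_ncard_compl A
    rw [Nat.card_coe_set_eq] at this
    rw [← this]; push_cast; ring
  have hcover : CoversBoundary R 𝒜 ℬ := by
    intro T a ha hT
    have hTm : T ∈ hammingBall n R := (Nat.le_succ _).trans hT
    have hSm : insert a T ∈ hammingBall n R := (card_insert_of_notMem ha).trans_le hT
    have hsd : symmDiff (insert a T) T = {a} := by
      ext y
      simp only [mem_symmDiff, mem_insert, mem_singleton]
      by_cases hy : y = a
      · subst hy; simp [ha]
      · simp [hy]
    rw [mem𝒜 _ hTm, mem𝒜 _ hSm, memℬ _ hTm, memℬ _ hSm]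
    refine ⟨fun h₁ h₂ => ⟨h₂, _, h₁, ?_⟩, fun h₁ h₂ => ⟨h₂, _, h₁, ?_⟩⟩
    · change (symmDiff (insert a T) T).card = 1
      rw [hsd, card_singleton]
    · change (symmDiff T (insert a T)).card = 1
      rw [symmDiff_comm, hsd, card_singleton]
  have hsize : ∀ S ∈ 𝒜, S.card ≤ R := by
    intro S hS
    obtain ⟨S', -, rfl⟩ := mem_map.1 hS
    exact S'.2
  have hpow : ρ ^ (3 / 2 : ℝ) = √ρ ^ 3 := by
    rw [Real.sqrt_eq_rpow, ← Real.rpow_natCast, ← Real.rpow_mul hρ.1.le]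
    norm_num
  have hmin : ((hammingBall n ⌊ρ * (n : ℝ)⌋₊).ncard : ℝ) ≤
      min (A.ncard : ℝ) ((Aᶜ : Set (hammingBall n R)).ncard : ℝ) :=
    le_min hA₁ (by rw [hcompl]; linarith)
  have hcard : Fintype.card (Fin n) = n := Fintype.card_fin n
  have key := hcover.le_card (by rw [hcard]; exact hR') hsize (by rw [hcard]; exact hn)
    hρ.1 hρ.2 (M := min (A.ncard : ℝ) ((Aᶜ : Set (hammingBall n R)).ncard : ℝ))
    (by rw [← card𝒜]; exact min_le_left _ _)
    (by rw [← card𝒜, hcard, ← ncard_hammingBall, ← hcompl]; exact min_le_right _ _)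
    (by rw [hcard, ← ncard_hammingBall]; exact hmin)
  rw [hcard] at key
  rw [hpow, cardℬ]
  exact key
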